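/- Let $(X,d)$ be a compact metric space and let $f:X\to X$ be a continuous map with the specification property: for every $\epsilon>0$ there is an integer $m=m(\epsilon)\ge 0$ such that for all integers $0\le a_1\le b_1,\ a_2\le b_2,\dots,a_k\le b_k$ with $a_{j+1}-b_j\ge m$ for $1\le j<k$, and all $x_1,\dots,x_k\in X$, there is $x\in X$ with $d(f^{a_j+p}(x),f^{p}(x_j))<\epsilon$ for all $1\le j\le k$ and all $0\le p\le b_j-a_j$. For $n\ge 1$ put $d_n(x,y)=\max_{0\le i<n}d(f^i(x),f^i(y))$ and $B_n(x,\epsilon)=\{y\in X: d_n(x,y)<\epsilon\}$. For $Z\subseteq X$, $\lambda\in\mathbb R$, $N\ge 1$ and $\epsilon>0$ let $$m(Z,\lambda,N,\epsilon)=\inf\sum_{i\in I}e^{-\lambda n_i},\qquad m(Z,\lambda,\epsilon)=\lim_{N\to\infty}m(Z,\lambda,N,\epsilon),$$ where the infimum is over all finite or countable families $\{B_{n_i}(x_i,\epsilon)\}_{i\in I}$ covering $Z$ with $n_i\ge N$ for all $i\in I$. Let $h^B_{top}(Z,f,\epsilon)=\inf\{\lambda\in\mathbb R: m(Z,\lambda,\epsilon)=0\}$.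 The Bowen upper and lower metric mean dimensions of $f$ on $Z$ are $$\overline{\mathrm{mdim}}^B_M(Z,f,d)=\limsup_{\epsilon\to0^+}\frac{h^B_{top}(Z,f,\epsilon)}{|\log\epsilon|},\qquad \underline{\mathrm{mdim}}^B_M(Z,f,d)=\liminf_{\epsilon\to0^+}\frac{h^B_{top}(Z,f,\epsilon)}{|\log\epsilon|}.$$ Let $s(f,X,n,\epsilon)$ be the largest cardinality of a set $E\subseteq X$ with $d_n(x,y)>\epsilon$ for all distinct $x,y\in E$. The upper and lower metric mean dimensions of $(X,f,d)$ are $$\overline{\mathrm{mdim}}_M(X,f,d)=\limsup_{\epsilon\to0^+}\frac{\limsup_{n\to\infty}\frac1n\log s(f,X,n,\epsilon)}{|\log\epsilon|},\qquad \underline{\mathrm{mdim}}_M(X,f,d)=\liminf_{\epsilon\to0^+}\frac{\limsup_{n\to\infty}\frac1n\log s(f,X,n,\epsilon)}{|\log\epsilon|}.$$ All these quantities are taken in $[-\infty,\infty]$. **Theorem.** Let $z_0\in X$ be a non-transitive point, i.e. $\overline{\{f^n(z_0):n\ge0\}}\ne X$, and let $E(z_0)=\{x\in X: z_0\notin\overline{\{f^n(x):n\ge0\}}\}$.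 Then either $E(z_0)=\emptyset$, or $$\overline{\mathrm{mdim}}^B_M(E(z_0),f,d)=\overline{\mathrm{mdim}}_M(X,f,d)\quad\text{and}\quad \underline{\mathrm{mdim}}^B_M(E(z_0),f,d)=\underline{\mathrm{mdim}}_M(X,f,d).$$ -/

import Mathlib

open Filter Set
open scoped Topology ENNReal

noncomputable section

namespace MetricMeanDim

variable {X : Type*}

/-- The forward orbit `{x, f x, f² x, …}`. -/
def orbit (f : X → X) (x : X) : Set X := Set.range fun n : ℕ => f^[n] x

/-- The points whose forward orbit closure misses `z₀`. -/
def nonDenseSet [TopologicalSpace X] (f : X → X) (z₀ : X) : Set X :=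
  {x | z₀ ∉ closure (orbit f x)}

/-- A point is non-transitive if its forward orbit is not dense. -/
def IsNonTransitive [TopologicalSpace X] (f : X → X) (z₀ : X) : Prop :=
  closure (orbit f z₀) ≠ Set.univ

/-- The specification property: for every `ε > 0` there is a gap length `m` such that any finite
list of orbit segments, prescribed on integer time intervals `[a 0, b 0], …, [a (k-1), b (k-1)]`
with gaps of length at least `m`, is `ε`-shadowed by one orbit. -/
def Specification [PseudoMetricSpace X] (f : X → X) : Prop :=
  ∀ ε : ℝ, 0 < ε → ∃ m : ℕ, ∀ (k : ℕ) (a b : ℕ → ℕ) (x : ℕ → X),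
    (∀ j < k, a j ≤ b j) →
    (∀ j, j + 1 < k → b j + m ≤ a (j + 1)) →
    ∃ y : X, ∀ j < k, ∀ p : ℕ, a j + p ≤ b j →
      dist (f^[a j + p] y) (f^[p] (x j)) < ε

/-- The Bowen metric `d_n(x, y) = max_{0 ≤ i < n} d(f^i x, f^i y)`. -/
def bowenDist [PseudoMetricSpace X] (f : X → X) (n : ℕ) (x y : X) : ℝ :=
  ⨆ i : Fin n, dist (f^[i] x) (f^[i] y)

/-- The open Bowen ball `B_n(x, ε)`. -/
def bowenBall [PseudoMetricSpace X] (f : X → X) (n : ℕ) (x : X) (ε : ℝ) : Set X :=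
  {y | bowenDist f n x y < ε}

/-- A finite or countable collection of Bowen balls `B_n(x, ε)`, listed by the pairs `(x, n)`,
which covers `Z` and has all orders `n ≥ N`. -/
def IsBowenCover [PseudoMetricSpace X] (f : X → X) (Z : Set X) (N : ℕ) (ε : ℝ)
    (c : Set (X × ℕ)) : Prop :=
  c.Countable ∧ (∀ q ∈ c, N ≤ q.2) ∧ Z ⊆ ⋃ q ∈ c, bowenBall f q.2 q.1 ε

/-- `m(Z, l, N, ε)`: the infimum of `∑ exp (-l n_i)` over the covers of `Z` by Bowen balls
`B_{n_i}(x_i, ε)` with all `n_i ≥ N`. -/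
def bowenMeasureAt [PseudoMetricSpace X] (f : X → X) (Z : Set X) (l : ℝ) (N : ℕ) (ε : ℝ) :
    ℝ≥0∞ :=
  ⨅ (c : Set (X × ℕ)) (_ : IsBowenCover f Z N ε c),
    ∑' q : c, ENNReal.ofReal (Real.exp (-l * (q : X × ℕ).2))

/-- `m(Z, l, ε)`: the limit of `m(Z, l, N, ε)` as `N → ∞`, which is the supremum because
`m(Z, l, N, ε)` is monotone in `N` (see `tendsto_bowenMeasureAt`). -/
def bowenMeasure [PseudoMetricSpace X] (f : X → X) (Z : Set X) (l ε : ℝ) : ℝ≥0∞ :=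
  ⨆ N : ℕ, bowenMeasureAt f Z l N ε

theorem monotone_bowenMeasureAt [PseudoMetricSpace X] (f : X → X) (Z : Set X) (l ε : ℝ) :
    Monotone fun N : ℕ => bowenMeasureAt f Z l N ε := fun _ _ hN =>
  le_iInf₂ fun c hc => iInf₂_le c ⟨hc.1, fun q hq => hN.trans (hc.2.1 q hq), hc.2.2⟩

theorem tendsto_bowenMeasureAt [PseudoMetricSpace X] (f : X → X) (Z : Set X) (l ε : ℝ) :
    Tendsto (fun N : ℕ => bowenMeasureAt f Z l N ε) atTop (𝓝 (bowenMeasure f Z l ε)) :=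
  tendsto_atTop_iSup (monotone_bowenMeasureAt f Z l ε)

/-- `h^B_top(Z, f, ε) = inf {l ∈ ℝ : m(Z, l, ε) = 0}`, in the extended reals. -/
def bowenEntropy [PseudoMetricSpace X] (f : X → X) (Z : Set X) (ε : ℝ) : EReal :=
  ⨅ (l : ℝ) (_ : bowenMeasure f Z l ε = 0), (l : EReal)

/-- The Bowen upper metric mean dimension of `f` on `Z`. -/
def bowenUpperMDim [PseudoMetricSpace X] (f : X → X) (Z : Set X) : EReal :=
  limsup (fun ε : ℝ => bowenEntropy f Z ε / ((|Real.log ε| : ℝ) : EReal)) (𝓝[>] 0)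

/-- The Bowen lower metric mean dimension of `f` on `Z`. -/
def bowenLowerMDim [PseudoMetricSpace X] (f : X → X) (Z : Set X) : EReal :=
  liminf (fun ε : ℝ => bowenEntropy f Z ε / ((|Real.log ε| : ℝ) : EReal)) (𝓝[>] 0)

/-- `(n, ε)`-separated sets. -/
def IsBowenSeparated [PseudoMetricSpace X] (f : X → X) (n : ℕ) (ε : ℝ) (E : Set X) : Prop :=
  ∀ x ∈ E, ∀ y ∈ E, x ≠ y → ε < bowenDist f n x y

/-- `s(f, X, n, ε)`: the largest cardinality of an `(n, ε)`-separated subset of `X`. -/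
def sepNumber [PseudoMetricSpace X] (f : X → X) (n : ℕ) (ε : ℝ) : ℕ∞ :=
  ⨆ (E : Set X) (_ : IsBowenSeparated f n ε E), E.encard

/-- `limsup_{n → ∞} (1/n) log s(f, X, n, ε)`. -/
def sepEntropy [PseudoMetricSpace X] (f : X → X) (ε : ℝ) : EReal :=
  limsup (fun n : ℕ => ENNReal.log ((sepNumber f n ε : ℕ∞) : ℝ≥0∞) / (n : EReal)) atTop

/-- The upper metric mean dimension of the whole system. -/
def upperMDim [PseudoMetricSpace X] (f : X → X) : EReal :=
  limsup (fun ε : ℝ => sepEntropy f ε / ((|Real.log ε| : ℝ) : EReal)) (𝓝[>] 0)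

/-- The lower metric mean dimension of the whole system. -/
def lowerMDim [PseudoMetricSpace X] (f : X → X) : EReal :=
  liminf (fun ε : ℝ => sepEntropy f ε / ((|Real.log ε| : ℝ) : EReal)) (𝓝[>] 0)

end MetricMeanDim

end

/-!
At every scale the Bowen entropy of `nonDenseSet f z₀` agrees with the separated-set entropy of the
whole space up to a fixed factor in the scale, and such a factor is invisible after dividing by
`|log ε|` and letting `ε → 0` (`limsup_div_abs_log_le`, `liminf_div_abs_log_le`).

* `bowenEntropy_le_sepEntropy`: the entropy of any set at scale `ε` is at most `sepEntropy` at scale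
  `ε / 2`, since maximal separated sets give covers by Bowen balls.
* `sepEntropy_le_bowenEntropy_nonDenseSet`: `sepEntropy` at scale `ε` is at most the entropy of
  `nonDenseSet f z₀` at scale `ε / 4`.

For the second bound, non-transitivity gives a point `w` outside the orbit closure of `z₀`. A point
very close to `z₀` follows the orbit of `z₀` for a long time and so stays away from `w`; hence an
orbit that visits a small ball around `w` with bounded gaps never comes close to `z₀`
(`mem_nonDenseSet_of_visiting`). By specification there are orbits which shadow arbitrary sequences
of segments taken from a large `(n, ε)`-separated set and visit that ball once in each period
(`Specification.exists_shadowing_visiting`). The period is `n` plus a constant, so no exponential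
growth is lost as `n → ∞`. The resulting points are coded by a full shift, and the uniform Bernoulli
measure on the code space bounds the sums `∑ exp (-l n_i)` from below
(`one_le_tsum_of_cylinder_cover`, `bowenMeasure_ne_zero_of_coding`).

In particular `nonDenseSet f z₀` is never empty here, and it is always the second alternative of the
theorem that is proved.
-/

namespace MetricMeanDim

/-! ### Cylinder covers of the full shift -/

open MeasureTheory in
/-- Kraft-type inequality: the uniform Bernoulli measure gives a cylinder of length `k` mass
`K⁻ᵏ`, and the total mass of the sequence space is one. -/
theorem one_le_tsum_of_cylinder_cover {ι : Type*} [Countable ι] {K : ℕ} [NeZero K]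
    (A : ι → Set (ℕ → Fin K)) (k : ι → ℕ) (hcov : ∀ ω, ∃ i, ω ∈ A i)
    (hA : ∀ i, ∀ ω ∈ A i, ∀ ω' ∈ A i, ∀ j < k i, ω j = ω' j) :
    1 ≤ ∑' i, ((K : ℝ≥0∞)⁻¹) ^ k i := by
  let μ : Measure (ℕ → Fin K) :=
    Measure.infinitePi fun _ => (PMF.uniformOfFintype (Fin K)).toMeasure
  have hbound : ∀ i, μ (A i) ≤ ((K : ℝ≥0∞)⁻¹) ^ k i := by
    intro i
    rcases (A i).eq_empty_or_nonempty with h | ⟨ω, hω⟩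
    · simp [h]
    · have hsub : A i ⊆ Set.pi (Finset.range (k i) : Finset ℕ) fun j => {ω j} := by
        intro ω' hω' j hj
        exact hA i ω' hω' ω hω j (by simpa using hj)
      refine (measure_mono hsub).trans ?_
      rw [Measure.infinitePi_pi _ fun _ _ => measurableSet_singleton _]
      simp
  have huniv : (Set.univ : Set (ℕ → Fin K)) = ⋃ i, A i := by
    ext ω
    simpa using hcov ω
  calc (1 : ℝ≥0∞) = μ Set.univ := measure_univ.symm
    _ ≤ ∑' i, μ (A i) := huniv ▸ measure_iUnion_le A
    _ ≤ _ := ENNReal.tsum_le_tsum hbound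

/-! ### Rescaling of `ε` -/

theorem map_mul_left_nhdsGT_zero {c : ℝ} (hc : 0 < c) :
    map (fun ε : ℝ => c * ε) (𝓝[>] 0) = 𝓝[>] 0 := by
  conv_lhs => rw [← comap_mulLeft_nhdsGT_zero hc]
  exact map_comap_of_surjective (mul_left_surjective₀ hc.ne') _

theorem tendsto_abs_log_mul_div_abs_log {c : ℝ} (hc : 0 < c) :
    Tendsto (fun ε : ℝ => |Real.log (c * ε)| / |Real.log ε|) (𝓝[>] 0) (𝓝 1) := by
  have h1 : Tendsto (fun ε : ℝ => |Real.log c / Real.log ε + 1|) (𝓝[>] 0) (𝓝 |0 + 1|) :=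
    ((tendsto_const_nhds.div_atBot Real.tendsto_log_nhdsGT_zero).add_const 1).abs
  rw [zero_add, abs_one] at h1
  refine h1.congr' ?_
  filter_upwards [self_mem_nhdsWithin,
    Real.tendsto_log_nhdsGT_zero.eventually (eventually_lt_atBot 0)] with ε hε hlog
  rw [← abs_div, Real.log_mul hc.ne' (ne_of_gt hε), add_div, div_self hlog.ne]

section Rescaling

variable {u v : ℝ → EReal} {c : ℝ}

theorem div_abs_log_le_mul (hc : 0 < c) (huv : ∀ ε, 0 < ε → u ε ≤ v (c * ε)) :
    ∀ᶠ ε in 𝓝[>] (0 : ℝ), u ε / ((|Real.log ε| : ℝ) : EReal) ≤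
      (((|Real.log (c * ε)| / |Real.log ε| : ℝ) : EReal)) *
        (v (c * ε) / ((|Real.log (c * ε)| : ℝ) : EReal)) := by
  have hmap : Tendsto (fun ε : ℝ => c * ε) (𝓝[>] 0) (𝓝[>] 0) := (map_mul_left_nhdsGT_zero hc).le
  filter_upwards [self_mem_nhdsWithin,
    (Real.tendsto_log_nhdsGT_zero.comp hmap).eventually (eventually_lt_atBot 0)] with ε hε hlog
  have hpos : (0 : ℝ) < |Real.log (c * ε)| := abs_pos.2 hlog.ne
  have h0 : (0 : EReal) ≤ ((|Real.log ε| : ℝ) : EReal) := by exact_mod_cast abs_nonneg _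
  refine (EReal.div_le_div_right_of_nonneg h0 (huv ε hε)).trans_eq ?_
  rw [EReal.coe_div, EReal.mul_div_right, EReal.mul_div_cancel (EReal.coe_ne_bot _)
    (EReal.coe_ne_top _) (by exact_mod_cast hpos.ne')]

/-- Replacing the scale `ε` by `c * ε` does not matter after division by `|log ε|`. -/
theorem limsup_div_abs_log_le (hc : 0 < c) (hv : ∀ ε, 0 < ε → 0 ≤ v ε)
    (huv : ∀ ε, 0 < ε → u ε ≤ v (c * ε)) :
    limsup (fun ε : ℝ => u ε / ((|Real.log ε| : ℝ) : EReal)) (𝓝[>] 0) ≤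
      limsup (fun ε : ℝ => v ε / ((|Real.log ε| : ℝ) : EReal)) (𝓝[>] 0) := by
  have hR := (EReal.tendsto_coe.2 (tendsto_abs_log_mul_div_abs_log hc)).limsup_eq
  refine (limsup_le_limsup (div_abs_log_le_mul hc huv)).trans ?_
  refine (EReal.limsup_mul_le (Eventually.of_forall fun ε => ?_).frequently ?_ ?_ ?_).trans_eq ?_
  · exact EReal.coe_nonneg.2 (by positivity)
  · filter_upwards [self_mem_nhdsWithin] with ε hε
    exact EReal.div_nonneg (hv _ (mul_pos hc hε)) (by exact_mod_cast abs_nonneg _)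
  · left; rw [hR]; simp
  · left; rw [hR]; exact EReal.coe_ne_top 1
  · rw [hR, EReal.coe_one, one_mul]
    conv_rhs => rw [← map_mul_left_nhdsGT_zero hc]
    rfl

theorem liminf_div_abs_log_le (hc : 0 < c) (hv : ∀ ε, 0 < ε → 0 ≤ v ε)
    (huv : ∀ ε, 0 < ε → u ε ≤ v (c * ε)) :
    liminf (fun ε : ℝ => u ε / ((|Real.log ε| : ℝ) : EReal)) (𝓝[>] 0) ≤
      liminf (fun ε : ℝ => v ε / ((|Real.log ε| : ℝ) : EReal)) (𝓝[>] 0) := by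
  have hR := (EReal.tendsto_coe.2 (tendsto_abs_log_mul_div_abs_log hc)).limsup_eq
  refine (liminf_le_liminf (div_abs_log_le_mul hc huv)).trans ?_
  refine (EReal.liminf_mul_le (Eventually.of_forall fun ε => ?_) ?_ ?_ ?_).trans_eq ?_
  · exact EReal.coe_nonneg.2 (by positivity)
  · filter_upwards [self_mem_nhdsWithin] with ε hε
    exact EReal.div_nonneg (hv _ (mul_pos hc hε)) (by exact_mod_cast abs_nonneg _)
  · left; rw [hR]; simp
  · left; rw [hR]; exact EReal.coe_ne_top 1
  · rw [hR, EReal.coe_one, one_mul]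
    conv_rhs => rw [← map_mul_left_nhdsGT_zero hc]
    rfl

end Rescaling

/-! ### Bowen metrics, separated sets and the upper bound -/

section BowenMetric

variable {X : Type*} [PseudoMetricSpace X] {f : X → X} {n : ℕ}

theorem dist_iterate_le_bowenDist {i : ℕ} (hi : i < n) (x y : X) :
    dist (f^[i] x) (f^[i] y) ≤ bowenDist f n x y :=
  le_ciSup (f := fun i : Fin n => dist (f^[i] x) (f^[i] y)) (Set.finite_range _).bddAbove ⟨i, hi⟩

theorem bowenDist_le {C : ℝ} (hC : 0 ≤ C) {x y : X}
    (h : ∀ i < n, dist (f^[i] x) (f^[i] y) ≤ C) : bowenDist f n x y ≤ C :=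
  Real.iSup_le (fun i => h i i.2) hC

theorem bowenDist_self (x : X) : bowenDist f n x x = 0 := by simp [bowenDist]

theorem bowenDist_comm (x y : X) : bowenDist f n x y = bowenDist f n y x := by
  simp [bowenDist, dist_comm]

theorem sepNumber_lt_of_log_div_lt {ε l : ℝ} (hn : 0 < n)
    (h : ENNReal.log ((sepNumber f n ε : ℕ∞) : ℝ≥0∞) / (n : EReal) < l) :
    ((sepNumber f n ε : ℕ∞) : ℝ≥0∞) < ENNReal.ofReal (Real.exp (l * n)) := by
  rw [EReal.div_lt_iff (by exact_mod_cast hn) (EReal.natCast_ne_top n)] at h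
  rw [← ENNReal.log_lt_log_iff, ENNReal.log_ofReal_of_pos (Real.exp_pos _), Real.log_exp]
  exact_mod_cast h

theorem lt_sepNumber_of_lt_log_div {ε l : ℝ} (hn : 0 < n)
    (h : l < ENNReal.log ((sepNumber f n ε : ℕ∞) : ℝ≥0∞) / (n : EReal)) :
    ENNReal.ofReal (Real.exp (l * n)) < ((sepNumber f n ε : ℕ∞) : ℝ≥0∞) := by
  rw [EReal.lt_div_iff (by exact_mod_cast hn) (EReal.natCast_ne_top n)] at h
  rw [← ENNReal.log_lt_log_iff, ENNReal.log_ofReal_of_pos (Real.exp_pos _), Real.log_exp]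
  exact_mod_cast h

/-- A separated set of the largest cardinality is spanning. -/
theorem exists_spanning_of_sepNumber_lt_top {ε : ℝ} (hε : 0 ≤ ε) (h : sepNumber f n ε < ⊤) :
    ∃ E : Set X, E.encard = sepNumber f n ε ∧ ∀ x, ∃ y ∈ E, bowenDist f n y x ≤ ε := by
  have heq : sepNumber f n ε = ⨆ E : {E : Set X // IsBowenSeparated f n ε E}, E.1.encard :=
    iSup_subtype'
  have : Nonempty {E : Set X // IsBowenSeparated f n ε E} := ⟨∅, by simp [IsBowenSeparated]⟩
  obtain ⟨⟨E, hE⟩, hcard⟩ := ENat.exists_eq_iSup_of_lt_top (heq ▸ h)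
  rw [← heq] at hcard
  refine ⟨E, hcard, fun x => ?_⟩
  by_contra! hx
  have hxE : x ∉ E := fun hxE => (hx x hxE).not_ge (by rwa [bowenDist_self])
  have hins : IsBowenSeparated f n ε (insert x E) := by
    rintro a (rfl | ha) b (rfl | hb) hab
    · exact absurd rfl hab
    · exact bowenDist_comm (f := f) a b ▸ hx b hb
    · exact hx a ha
    · exact hE a ha b hb hab
  have hle : (insert x E).encard ≤ sepNumber f n ε :=
    le_iSup₂ (f := fun (E : Set X) (_ : IsBowenSeparated f n ε E) => E.encard) _ hins
  rw [Set.encard_insert_of_notMem hxE] at hle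
  dsimp only at hcard
  rw [hcard] at hle
  exact ((ENat.lt_add_one_iff h.ne).2 le_rfl).not_ge hle

/-- An `(n, ε)`-separated family indexed by `Fin K`, with `K` larger than a given lower bound of
the maximal cardinality. -/
theorem exists_separated_family {ε r : ℝ} (hr : 0 ≤ r)
    (h : ENNReal.ofReal r < ((sepNumber f n ε : ℕ∞) : ℝ≥0∞)) :
    ∃ (K : ℕ) (e : Fin K → X), r < K ∧ ∀ i j, i ≠ j → ε < bowenDist f n (e i) (e j) := by
  have h1 : ((⌊r⌋₊ : ℕ∞) : ℝ≥0∞) < ((sepNumber f n ε : ℕ∞) : ℝ≥0∞) := by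
    refine lt_of_le_of_lt ?_ h
    rw [ENat.toENNReal_coe, ← ENNReal.ofReal_natCast]
    exact ENNReal.ofReal_le_ofReal (Nat.floor_le hr)
  rw [ENat.toENNReal_lt] at h1
  obtain ⟨E, hE⟩ := lt_iSup_iff.1 h1
  obtain ⟨hsep, hE⟩ := lt_iSup_iff.1 hE
  obtain ⟨t, htE, ht⟩ := Set.exists_subset_encard_eq (Order.add_one_le_of_lt hE)
  have hfin : t.Finite := Set.finite_of_encard_eq_coe (k := ⌊r⌋₊ + 1) (by exact_mod_cast ht)
  have hcard : hfin.toFinset.card = ⌊r⌋₊ + 1 := by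
    rw [hfin.encard_eq_coe_toFinset_card] at ht
    exact_mod_cast ht
  refine ⟨⌊r⌋₊ + 1, fun i => (hfin.toFinset.equivFinOfCardEq hcard).symm i, ?_, ?_⟩
  · exact_mod_cast Nat.lt_floor_add_one r
  · intro i j hij
    refine hsep _ (htE ?_) _ (htE ?_) ?_
    · exact hfin.mem_toFinset.1 (Subtype.property _)
    · exact hfin.mem_toFinset.1 (Subtype.property _)
    · exact fun h => hij ((Equiv.injective _) (Subtype.ext h))

theorem sepEntropy_nonneg [Nonempty X] (f : X → X) (ε : ℝ) : 0 ≤ sepEntropy f ε := by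
  refine le_limsup_of_frequently_le (Eventually.of_forall fun n => ?_).frequently
  obtain ⟨x⟩ := ‹Nonempty X›
  have h1 : (1 : ℕ∞) ≤ sepNumber f n ε := by
    rw [← Set.encard_singleton x]
    refine le_iSup₂ (f := fun (E : Set X) (_ : IsBowenSeparated f n ε E) => E.encard) {x} ?_
    rintro a rfl b rfl hab
    exact absurd rfl hab
  refine EReal.div_nonneg (ENNReal.zero_le_log_iff.2 ?_) (by exact_mod_cast n.zero_le)
  exact_mod_cast h1

/-- The Bowen balls of order `n` around a maximal separated set form a cover. The scale drops to
`ε / 2` because the balls are open. -/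
theorem bowenEntropy_le_sepEntropy (f : X → X) (Z : Set X) {ε : ℝ} (hε : 0 < ε) :
    bowenEntropy f Z ε ≤ sepEntropy f (ε / 2) := by
  refine EReal.le_of_forall_lt_iff_le.1 fun l hl => iInf₂_le l ?_
  obtain ⟨l', hl'1, hl'2⟩ := EReal.lt_iff_exists_real_btwn.1 hl
  have hll : l' < l := by exact_mod_cast hl'2
  refine (ENNReal.iSup_eq_zero).2 fun N => ?_
  have hlim : Tendsto (fun n : ℕ => ENNReal.ofReal (Real.exp ((l' - l) * n))) atTop (𝓝 0) := by
    rw [← ENNReal.ofReal_zero]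
    refine ENNReal.tendsto_ofReal (Real.tendsto_exp_atBot.comp ?_)
    exact tendsto_natCast_atTop_atTop.const_mul_atTop_of_neg (sub_neg.2 hll)
  refine le_antisymm (ge_of_tendsto hlim ?_) zero_le
  filter_upwards [eventually_lt_of_limsup_lt hl'1, eventually_ge_atTop N, eventually_gt_atTop 0]
    with n hn hnN hn0
  have hs := sepNumber_lt_of_log_div_lt hn0 hn
  have hs' : sepNumber f n (ε / 2) < ⊤ := by
    rw [← ENat.toENNReal_lt, ENat.toENNReal_top]
    exact hs.trans ENNReal.ofReal_lt_top
  obtain ⟨E, hE, hspan⟩ := exists_spanning_of_sepNumber_lt_top (by positivity) hs'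
  have hfin : E.Finite := by
    rw [← Set.encard_lt_top_iff, hE]; exact hs'
  let c : Set (X × ℕ) := (fun x => (x, n)) '' E
  have hc : IsBowenCover f Z N ε c := by
    refine ⟨(hfin.image _).countable, ?_, fun x _ => ?_⟩
    · rintro _ ⟨x, -, rfl⟩
      exact hnN
    · obtain ⟨y, hy, hyx⟩ := hspan x
      simp only [Set.mem_iUnion]
      exact ⟨(y, n), ⟨y, hy, rfl⟩, lt_of_le_of_lt hyx (by linarith)⟩
  calc bowenMeasureAt f Z l N ε
      ≤ ∑' q : c, ENNReal.ofReal (Real.exp (-l * (q : X × ℕ).2)) := iInf₂_le c hc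
    _ = ∑' _ : c, ENNReal.ofReal (Real.exp (-l * n)) := by
        refine tsum_congr ?_
        rintro ⟨_, x, -, rfl⟩
        rfl
    _ = (c.encard : ℝ≥0∞) * ENNReal.ofReal (Real.exp (-l * n)) := ENNReal.tsum_set_const _ _
    _ ≤ ENNReal.ofReal (Real.exp (l' * n)) * ENNReal.ofReal (Real.exp (-l * n)) := by
        gcongr
        refine le_trans ?_ hs.le
        rw [ENat.toENNReal_le, ← hE]
        exact Set.encard_image_le _ _
    _ = ENNReal.ofReal (Real.exp ((l' - l) * n)) := by
        rw [← ENNReal.ofReal_mul (Real.exp_pos _).le, ← Real.exp_add]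
        ring_nf

end BowenMetric

/-! ### Specification, avoidance of `z₀` and the lower bound -/

section Shadowing

variable {X : Type*} [PseudoMetricSpace X] {f : X → X}

/-- By compactness the specification property extends to infinitely many orbit segments. -/
theorem Specification.exists_shadowing [CompactSpace X] (hspec : Specification f)
    (hf : Continuous f) {δ : ℝ} (hδ : 0 < δ) :
    ∃ m : ℕ, ∀ (a b : ℕ → ℕ) (x : ℕ → X), (∀ j, a j ≤ b j) → (∀ j, b j + m ≤ a (j + 1)) →
      ∃ y : X, ∀ j p, a j + p ≤ b j → dist (f^[a j + p] y) (f^[p] (x j)) ≤ δ := by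
  obtain ⟨m, hm⟩ := hspec δ hδ
  refine ⟨m, fun a b x hab hgap => ?_⟩
  let S : ℕ → Set X := fun k =>
    {y | ∀ j < k, ∀ p, a j + p ≤ b j → dist (f^[a j + p] y) (f^[p] (x j)) ≤ δ}
  have hclosed : ∀ k, IsClosed (S k) := by
    intro k
    simp only [S, Set.ofPred_forall]
    exact isClosed_iInter fun j => isClosed_iInter fun _ => isClosed_iInter fun p =>
      isClosed_iInter fun _ => isClosed_le ((hf.iterate _).dist continuous_const) continuous_const
  obtain ⟨y, hy⟩ := IsCompact.nonempty_iInter_of_sequence_nonempty_isCompact_isClosed S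
    (fun k y hy j hj => hy j (hj.trans k.lt_succ_self))
    (fun k => (hm k a b x (fun j _ => hab j) (fun j _ => hgap j)).imp
      fun y hy j hj p hp => (hy j hj p hp).le)
    (hclosed 0).isCompact hclosed
  exact ⟨y, fun j p hp => Set.mem_iInter.1 hy (j + 1) j j.lt_succ_self p hp⟩

/-- Arbitrary orbit segments of length `n` can be shadowed periodically, with a visit near a fixed
point `w` between any two of them. The period exceeds `n` by an amount independent of `n`. -/
theorem Specification.exists_shadowing_visiting [CompactSpace X] (hspec : Specification f)
    (hf : Continuous f) {δ : ℝ} (hδ : 0 < δ) (w : X) :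
    ∃ M : ℕ, ∀ n, 0 < n → ∃ q < n + M, ∀ x : ℕ → X, ∃ y : X,
      (∀ j, ∀ i < n, dist (f^[j * (n + M) + i] y) (f^[i] (x j)) ≤ δ) ∧
      ∀ j, dist (f^[j * (n + M) + q] y) w ≤ δ := by
  obtain ⟨m, hm⟩ := hspec.exists_shadowing hf hδ
  refine ⟨2 * m + 1, fun n hn => ⟨n + m, by omega, fun x => ?_⟩⟩
  -- Even-numbered segments carry the prescribed orbits, odd-numbered ones are single visits to `w`.
  obtain ⟨y, hy⟩ := hm
    (fun j => j / 2 * (n + (2 * m + 1)) + if j % 2 = 0 then 0 else n + m)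
    (fun j => j / 2 * (n + (2 * m + 1)) + if j % 2 = 0 then n - 1 else n + m)
    (fun j => if j % 2 = 0 then x (j / 2) else w)
    (fun j => by split_ifs <;> omega)
    (fun j => by
      rcases Nat.even_or_odd' j with ⟨i, rfl | rfl⟩
      · have h1 : (2 * i + 1) / 2 = i := by omega
        have h2 : (2 * i + 1) % 2 = 1 := by omega
        simp [h1, h2]
        omega
      · have h1 : (2 * i + 1) / 2 = i := by omega
        have h2 : (2 * i + 1) % 2 = 1 := by omega
        have h3 : (2 * i + 1 + 1) / 2 = i + 1 := by omega
        have h4 : (2 * i + 1 + 1) % 2 = 0 := by omega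
        simp only [h1, h2, h3, h4, add_mul]
        simp
        omega)
  refine ⟨y, fun j i hi => ?_, fun j => ?_⟩
  · have := hy (2 * j) i
    simp at this
    exact this (by omega)
  · have := hy (2 * j + 1) 0
    have h1 : (2 * j + 1) / 2 = j := by omega
    have h2 : (2 * j + 1) % 2 = 1 := by omega
    simp [h1, h2] at this
    exact this

/-- If the orbit of `z₀` stays away from `w`, then an orbit visiting a neighbourhood of `w` with
bounded gaps cannot come close to `z₀`: it would follow the orbit of `z₀` for a full gap. -/
theorem mem_nonDenseSet_of_visiting (hf : Continuous f) {z₀ w y : X} {r δ : ℝ} {T q : ℕ}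
    (hr : ∀ n, r ≤ dist (f^[n] z₀) w) (hδ : δ < r) (hq : q < T)
    (hy : ∀ j, dist (f^[j * T + q] y) w ≤ δ) : y ∈ nonDenseSet f z₀ := by
  intro hcl
  have hU : ∀ᶠ u in 𝓝 z₀, ∀ i ∈ Finset.range (2 * T), dist (f^[i] u) (f^[i] z₀) < r - δ := by
    rw [Finset.eventually_all]
    intro i _
    have : Tendsto (fun u => dist (f^[i] u) (f^[i] z₀)) (𝓝 z₀) (𝓝 0) := by
      simpa using (((hf.iterate i).dist continuous_const).tendsto z₀ :
        Tendsto (fun u => dist (f^[i] u) (f^[i] z₀)) (𝓝 z₀) (𝓝 (dist (f^[i] z₀) (f^[i] z₀))))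
    exact this.eventually (gt_mem_nhds (sub_pos.2 hδ))
  obtain ⟨u, hu, k, rfl⟩ := mem_closure_iff_nhds.1 hcl _ hU
  have hT : 0 < T := by omega
  -- The first visit time in the period after the one containing `k`.
  have hk := Nat.div_add_mod k T
  have hkT := Nat.mod_lt k hT
  have hexp : (k / T + 1) * T = T * (k / T) + T := by ring
  obtain ⟨i, hi⟩ : ∃ i, k + i = (k / T + 1) * T + q := ⟨T + q - k % T, by omega⟩
  have h1 := hu i (Finset.mem_range.2 (by omega))
  have h2 := hy (k / T + 1)
  dsimp only at h1
  rw [← Function.iterate_add_apply, add_comm i k, hi, dist_comm] at h1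
  have h3 := dist_triangle (f^[i] z₀) (f^[(k / T + 1) * T + q] y) w
  linarith [hr i]

theorem IsNonTransitive.exists_forall_le_dist {z₀ : X} (hz₀ : IsNonTransitive f z₀) :
    ∃ (w : X) (r : ℝ), 0 < r ∧ ∀ n, r ≤ dist (f^[n] z₀) w := by
  obtain ⟨w, hw⟩ := (Set.ne_univ_iff_exists_notMem _).1 hz₀
  rw [Metric.mem_closure_iff] at hw
  push Not at hw
  obtain ⟨r, hr, h⟩ := hw
  exact ⟨w, r, hr, fun n => dist_comm w (f^[n] z₀) ▸ h _ ⟨n, rfl⟩⟩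

/-- Mass distribution principle for a subset of `Z` coded by the full shift on `K` symbols: a Bowen
ball of order `n` determines the first `n / T` symbols of the code, so it weighs at most
`K ^ (-(n / T))`. -/
theorem bowenMeasure_ne_zero_of_coding {Z : Set X} {K n T : ℕ} {ε l : ℝ} (hT : 0 < T)
    (hnT : n ≤ T) (hK : Real.exp (l * T) ≤ K) {e : Fin K → X} (hε : 0 < ε)
    (hsep : ∀ i j, i ≠ j → ε < bowenDist f n (e i) (e j)) (y : (ℕ → Fin K) → X)
    (hyZ : ∀ ω, y ω ∈ Z)
    (hy : ∀ ω j, ∀ i < n, dist (f^[j * T + i] (y ω)) (f^[i] (e (ω j))) ≤ ε / 4) :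
    bowenMeasure f Z l (ε / 4) ≠ 0 := by
  have hK0 : (0 : ℝ) < K := (Real.exp_pos _).trans_le hK
  have : NeZero K := ⟨by rintro rfl; simp at hK0⟩
  let C : ℝ≥0∞ := ENNReal.ofReal (Real.exp (|l| * T))
  have hC : C⁻¹ ≠ 0 := ENNReal.inv_ne_zero.2 ENNReal.ofReal_ne_top
  have hC0 : C ≠ 0 := by simp [C, Real.exp_pos]
  suffices h : C⁻¹ ≤ bowenMeasureAt f Z l 0 (ε / 4) from fun h0 =>
    hC (le_antisymm ((h.trans (le_iSup (fun N => bowenMeasureAt f Z l N (ε / 4)) 0)).trans_eq h0)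
      zero_le)
  refine le_iInf₂ fun c hc => ?_
  have := hc.1.to_subtype
  have hkraft := one_le_tsum_of_cylinder_cover
    (fun q : c => {ω | y ω ∈ bowenBall f (q : X × ℕ).2 (q : X × ℕ).1 (ε / 4)})
    (fun q => (q : X × ℕ).2 / T)
    (fun ω => by simpa using hc.2.2 (hyZ ω))
    (by
      intro q ω hω ω' hω' j hj
      by_contra hne
      refine (hsep _ _ hne).not_ge (bowenDist_le hε.le fun i hi => ?_)
      have hlt : j * T + i < (q : X × ℕ).2 :=
        calc j * T + i < (j + 1) * T := by rw [add_mul]; omega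
          _ ≤ (q : X × ℕ).2 / T * T := Nat.mul_le_mul_right T hj
          _ ≤ _ := Nat.div_mul_le_self _ _
      have h1 := (dist_iterate_le_bowenDist (f := f) hlt _ _).trans_lt hω
      have h2 := (dist_iterate_le_bowenDist (f := f) hlt _ _).trans_lt hω'
      have h3 := hy ω j i hi
      have h4 := hy ω' j i hi
      have t1 := dist_triangle4 (f^[i] (e (ω j))) (f^[j * T + i] (y ω))
        (f^[j * T + i] (y ω')) (f^[i] (e (ω' j)))
      have t2 := dist_triangle_left (f^[j * T + i] (y ω)) (f^[j * T + i] (y ω'))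
        (f^[j * T + i] (q : X × ℕ).1)
      rw [dist_comm (f^[i] (e (ω j))) (f^[j * T + i] (y ω))] at t1
      linarith)
  rw [ENNReal.inv_le_iff_le_mul (fun _ => hC0) (fun h => absurd h ENNReal.ofReal_ne_top),
    ← ENNReal.tsum_mul_left]
  refine hkraft.trans (ENNReal.tsum_le_tsum fun q => ?_)
  set N := (q : X × ℕ).2
  have hinv : ((K : ℝ≥0∞)⁻¹) ^ (N / T) = ENNReal.ofReal (((K : ℝ)⁻¹) ^ (N / T)) := by
    rw [ENNReal.ofReal_pow (by positivity), ENNReal.ofReal_inv_of_pos hK0, ENNReal.ofReal_natCast]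
  rw [hinv, ← ENNReal.ofReal_mul (Real.exp_pos _).le, ← Real.exp_add]
  refine ENNReal.ofReal_le_ofReal ?_
  have hdm : ((T : ℝ) * (N / T : ℕ) + (N % T : ℕ)) = N := by exact_mod_cast Nat.div_add_mod N T
  have hmod : ((N % T : ℕ) : ℝ) ≤ T := by exact_mod_cast (Nat.mod_lt N hT).le
  calc ((K : ℝ)⁻¹) ^ (N / T) ≤ ((Real.exp (l * T))⁻¹) ^ (N / T) := by gcongr
    _ = Real.exp ((N / T : ℕ) * -(l * T)) := by rw [← Real.exp_neg, ← Real.exp_nat_mul]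
    _ ≤ _ := by
        refine Real.exp_le_exp.2 ?_
        have h1 : l * (N % T : ℕ) ≤ |l| * T :=
          mul_le_mul (le_abs_self l) hmod (Nat.cast_nonneg _) (abs_nonneg l)
        rw [← hdm]
        linarith

/-- Points shadowing separated segments and returning near `w ∉ closure (orbit f z₀)` with bounded
gaps already carry the full entropy at scale `ε`, and they avoid `z₀`. -/
theorem sepEntropy_le_bowenEntropy_nonDenseSet [CompactSpace X] (hf : Continuous f)
    (hspec : Specification f) {z₀ : X} (hz₀ : IsNonTransitive f z₀) {ε : ℝ} (hε : 0 < ε) :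
    sepEntropy f ε ≤ bowenEntropy f (nonDenseSet f z₀) (ε / 4) := by
  obtain ⟨w, r, hr, hw⟩ := hz₀.exists_forall_le_dist
  have hδ : 0 < min (ε / 4) (r / 2) := by positivity
  obtain ⟨M, hM⟩ := hspec.exists_shadowing_visiting hf hδ w
  refine le_iInf₂ fun l hl => ?_
  by_contra! hlt
  obtain ⟨l', hl'1, hl'2⟩ := EReal.lt_iff_exists_real_btwn.1 hlt
  have hll : l < l' := by exact_mod_cast hl'1
  -- For large `n` the bounded excess `M` of the period over `n` is absorbed by `l' - l`.
  have hlarge : ∀ᶠ n : ℕ in atTop, l * M ≤ (l' - l) * n :=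
    (tendsto_natCast_atTop_atTop.const_mul_atTop (sub_pos.2 hll)).eventually_ge_atTop _
  obtain ⟨n, hn, hnM, hn0⟩ := ((frequently_lt_of_lt_limsup (h := hl'2)).and_eventually
    (hlarge.and (eventually_gt_atTop 0))).exists
  obtain ⟨K, e, hK, hsep⟩ :=
    exists_separated_family (Real.exp_pos _).le (lt_sepNumber_of_lt_log_div hn0 hn)
  obtain ⟨q, hq, hshadow⟩ := hM n hn0
  choose y hy hyw using fun ω : ℕ → Fin K => hshadow fun j => e (ω j)
  refine bowenMeasure_ne_zero_of_coding (T := n + M) (by omega) (by omega) ?_ hε hsep y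
    (fun ω => mem_nonDenseSet_of_visiting hf hw (half_lt_self hr) hq fun j =>
      (hyw ω j).trans (min_le_right _ _))
    (fun ω j i hi => (hy ω j i hi).trans (min_le_left _ _)) hl
  refine le_trans (Real.exp_le_exp.2 ?_) hK.le
  push_cast
  linarith

end Shadowing

end MetricMeanDim

theorem theorem1p1 {X : Type*} [MetricSpace X] [CompactSpace X]
    (f : X → X) (hf : Continuous f) (hspec : MetricMeanDim.Specification f)
    (z₀ : X) (hz₀ : MetricMeanDim.IsNonTransitive f z₀) :
    MetricMeanDim.nonDenseSet f z₀ = ∅ ∨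
      (MetricMeanDim.bowenUpperMDim f (MetricMeanDim.nonDenseSet f z₀) =
          MetricMeanDim.upperMDim f ∧
        MetricMeanDim.bowenLowerMDim f (MetricMeanDim.nonDenseSet f z₀) =
          MetricMeanDim.lowerMDim f) := by
  have : Nonempty X := ⟨z₀⟩
  have hle : ∀ ε : ℝ, 0 < ε → MetricMeanDim.bowenEntropy f (MetricMeanDim.nonDenseSet f z₀) ε ≤
      MetricMeanDim.sepEntropy f (1 / 2 * ε) := fun ε hε => by
    rw [one_div_mul_eq_div]
    exact MetricMeanDim.bowenEntropy_le_sepEntropy f _ hε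
  have hge : ∀ ε : ℝ, 0 < ε → MetricMeanDim.sepEntropy f ε ≤
      MetricMeanDim.bowenEntropy f (MetricMeanDim.nonDenseSet f z₀) (1 / 4 * ε) := fun ε hε => by
    rw [one_div_mul_eq_div]
    exact MetricMeanDim.sepEntropy_le_bowenEntropy_nonDenseSet hf hspec hz₀ hε
  have hs : ∀ ε : ℝ, 0 < ε → 0 ≤ MetricMeanDim.sepEntropy f ε :=
    fun ε _ => MetricMeanDim.sepEntropy_nonneg f ε
  have hb : ∀ ε : ℝ, 0 < ε → 0 ≤ MetricMeanDim.bowenEntropy f (MetricMeanDim.nonDenseSet f z₀) ε :=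
    fun ε hε => by
      have h := (MetricMeanDim.sepEntropy_nonneg f (4 * ε)).trans (hge (4 * ε) (by positivity))
      rwa [← mul_assoc, one_div_mul_cancel four_ne_zero, one_mul] at h
  right
  exact ⟨le_antisymm (MetricMeanDim.limsup_div_abs_log_le (by norm_num) hs hle)
      (MetricMeanDim.limsup_div_abs_log_le (by norm_num) hb hge),
    le_antisymm (MetricMeanDim.liminf_div_abs_log_le (by norm_num) hs hle)
      (MetricMeanDim.liminf_div_abs_log_le (by norm_num) hb hge)⟩
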